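/- Let $\sigma(z)=\max(0,z)$ be the ReLU function, and for $d\ge 1$ let $\Omega=(0,1)^d$ and $$\mathcal F_\sigma=\{x\mapsto\sigma(\omega\cdot x+t):\ \omega\in\mathbb R^d,\ |\omega|_1=1,\ t\in[-1,1]\}.$$ Write $\|f\|_{H^1(\Omega)}^2=\int_\Omega |f|^2\,dx+\int_\Omega|\nabla f|^2\,dx$, with $\nabla f$ the weak gradient and $|\cdot|$ the Euclidean norm. For $n\ge 1$ let $$\epsilon_n(\mathcal F_\sigma)=\inf\{\epsilon\ge 0:\ \mathcal F_\sigma\text{ can be covered by at most } n \text{ sets of diameter}\le\epsilon\text{ in the } H^1(\Omega)\text{ norm}\}.$$ Then there is a universal constant $c>0$, independent of $d$ and $n$, such that for every integer $d\ge 1$ one has $\mathcal F_\sigma\subset H^1(\Omega)$ and, for every integer $n\ge 1$, $$\epsilon_n(\mathcal F_\sigma)\le c\,n^{-\frac1{3d}}.$$ -/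

import Mathlib

open MeasureTheory Set
open scoped ENNReal ContDiff

/-- The open unit cube `(0,1)^d` in `ℝ^d`. -/
def unitCube (d : ℕ) : Set (Fin d → ℝ) :=
  {x | ∀ i, x i ∈ Ioo (0 : ℝ) 1}

/-- `g = (g 0, …, g (d-1))` is a weak gradient of `f` on `Ω`: all functions are locally integrable
on `Ω`, and `∫_Ω f ∂ᵢφ = - ∫_Ω gᵢ φ` for every `i` and every test function `φ ∈ C_c^∞(Ω)`. -/
structure HasWeakGradient {d : ℕ} (Ω : Set (Fin d → ℝ)) (f : (Fin d → ℝ) → ℝ)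
    (g : Fin d → (Fin d → ℝ) → ℝ) : Prop where
  locallyIntegrableOn : LocallyIntegrableOn f Ω volume
  locallyIntegrableOn_grad : ∀ i, LocallyIntegrableOn (g i) Ω volume
  integral_eq : ∀ (i : Fin d) (φ : (Fin d → ℝ) → ℝ), ContDiff ℝ ∞ φ → HasCompactSupport φ →
    tsupport φ ⊆ Ω →
      ∫ x in Ω, f x * fderiv ℝ φ x (Pi.single i 1) = - ∫ x in Ω, g i x * φ x

/-- `f` belongs to the Sobolev space `H¹(Ω)`. -/
def MemH1 {d : ℕ} (Ω : Set (Fin d → ℝ)) (f : (Fin d → ℝ) → ℝ) : Prop :=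
  ∃ g : Fin d → (Fin d → ℝ) → ℝ, HasWeakGradient Ω f g ∧
    MemLp f 2 (volume.restrict Ω) ∧ ∀ i, MemLp (g i) 2 (volume.restrict Ω)

/-- The `H¹(Ω)` norm `(‖f‖²_{L²(Ω)} + ‖∇f‖²_{L²(Ω)})^{1/2}` with values in `[0, ∞]`. On an open
set the weak gradient is unique up to null sets, so the infimum is over at most one value; it is
`∞` when `f` has no weak gradient. -/
noncomputable def eH1Norm {d : ℕ} (Ω : Set (Fin d → ℝ)) (f : (Fin d → ℝ) → ℝ) : ℝ≥0∞ :=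
  ⨅ (g : Fin d → (Fin d → ℝ) → ℝ) (_ : HasWeakGradient Ω f g),
    (eLpNorm f 2 (volume.restrict Ω) ^ 2
      + ∑ i, eLpNorm (g i) 2 (volume.restrict Ω) ^ 2) ^ (1 / 2 : ℝ)

/-- The `n`-th metric entropy `ε_n(S)` of a set `S` of functions under the `H¹(Ω)` norm: the infimum
of all `ε` such that `S` can be covered by at most `n` sets of diameter at most `ε`
(some of the sets `A i` may be empty or coincide). -/
noncomputable def metricEntropyH1 {d : ℕ} (Ω : Set (Fin d → ℝ)) (S : Set ((Fin d → ℝ) → ℝ))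
    (n : ℕ) : ℝ≥0∞ :=
  sInf {ε : ℝ≥0∞ | ∃ A : Fin n → Set ((Fin d → ℝ) → ℝ), S ⊆ ⋃ i, A i ∧
    ∀ i, ∀ f ∈ A i, ∀ g ∈ A i, eH1Norm Ω (f - g) ≤ ε}

/-- The ReLU activation function. -/
noncomputable def relu (z : ℝ) : ℝ := max z 0

/-- The dictionary of ridge functions `x ↦ σ(w·x + t)` with `|w|₁ = 1` and `t ∈ [-1,1]`. -/
def reluDictionary (d : ℕ) : Set ((Fin d → ℝ) → ℝ) :=
  {f | ∃ (w : Fin d → ℝ) (t : ℝ), ∑ i, |w i| = 1 ∧ t ∈ Icc (-1 : ℝ) 1 ∧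
    f = fun x => relu (∑ i, w i * x i + t)}

/-! The map from (w, t) to the ridge function is Hölder of order 1/2 into H¹, with a constant free
of d, so a cover of the parameters yields a cover of the dictionary. For parameters at ℓ¹-distance
at most δ, the affine functions differ by at most δ on the cube. Hence the gradients differ by w -
w' except where the signs disagree, which lies in the slab |w·x + t| ≤ δ. That slab can have volume
of order δ/|w k|, with w k the largest entry, but the squared gradient there is at most |w|₂² ≤ |w
k| |w|₁ = |w k|. The two factors cancel, and so the dimension disappears (`volume_slab_le`,
`eH1Norm_reluRidge_sub_le`). A volume count in dimension d + 1 covers the parameters at scale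
n^(-1/(d+1)). For d ≥ 2 this is at most n^(-2/(3d)), whose square root is the claimed rate; d = 1
uses that the sphere is two points. -/

/-! ### Covering the parameter set. -/

/-- An `r`-separated subset of the unit ball has at most `(3 / r) ^ dim` points. -/
theorem card_le_of_separated_of_norm_le_one {E : Type*} [NormedAddCommGroup E] [NormedSpace ℝ E]
    [FiniteDimensional ℝ E] {r : ℝ} (hr : 0 < r) (hr1 : r ≤ 1) (s : Finset E)
    (hs : ∀ c ∈ s, ‖c‖ ≤ 1) (h : ∀ c ∈ s, ∀ d ∈ s, c ≠ d → r ≤ ‖c - d‖) :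
    (s.card : ℝ) ≤ (3 / r) ^ Module.finrank ℝ E := by
  borelize E
  let μ : Measure E := Measure.addHaar
  have hr2 : 0 < r / 2 := by positivity
  have hρ : (0 : ℝ) < 3 / 2 := by norm_num
  have D : Set.Pairwise (s : Set E)
      (Function.onFun Disjoint fun c => Metric.ball (c : E) (r / 2)) := by
    rintro c hc d hd hcd
    apply Metric.ball_disjoint_ball
    rw [dist_eq_norm]
    linarith [h c hc d hd hcd]
  -- The radius 3/2 comes from 1 + r/2 with r ≤ 1.
  have hsub : (⋃ c ∈ s, Metric.ball (c : E) (r / 2)) ⊆ Metric.ball (0 : E) (3 / 2) := by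
    refine iUnion₂_subset fun x hx => Metric.ball_subset_ball' ?_
    rw [dist_zero_right]
    linarith [hs x hx]
  have I : (s.card : ℝ≥0∞) * ENNReal.ofReal ((r / 2) ^ Module.finrank ℝ E) * μ (Metric.ball 0 1) ≤
      ENNReal.ofReal ((3 / 2) ^ Module.finrank ℝ E) * μ (Metric.ball 0 1) := by
    have := measure_mono (μ := μ) hsub
    rw [measure_biUnion_finset D fun c _ => measurableSet_ball] at this
    simpa only [μ.addHaar_ball_of_pos _ hr2, μ.addHaar_ball_of_pos _ hρ, Finset.sum_const,
      nsmul_eq_mul, mul_assoc] using this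
  have J := (ENNReal.mul_le_mul_iff_left (Metric.measure_ball_pos _ _ zero_lt_one).ne'
    measure_ball_lt_top.ne).1 I
  have K : (s.card : ℝ) * (r / 2) ^ Module.finrank ℝ E ≤ (3 / 2) ^ Module.finrank ℝ E := by
    have := ENNReal.toReal_le_of_le_ofReal (by positivity) J
    rwa [ENNReal.toReal_mul, ENNReal.toReal_natCast, ENNReal.toReal_ofReal (by positivity)] at this
  have h3 : (3 / r : ℝ) = (3 / 2) / (r / 2) := by field_simp
  rwa [h3, div_pow, le_div_iff₀ (by positivity)]

/-- The unit ball is covered by at most `(3 / r) ^ dim` balls of radius `r`. -/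
theorem exists_finset_cover_unit_ball (E : Type*) [NormedAddCommGroup E] [NormedSpace ℝ E]
    [FiniteDimensional ℝ E] {r : ℝ} (hr : 0 < r) (hr1 : r ≤ 1) :
    ∃ s : Finset E, (s.card : ℝ) ≤ (3 / r) ^ Module.finrank ℝ E ∧
      ∀ x : E, ‖x‖ ≤ 1 → ∃ c ∈ s, ‖x - c‖ ≤ r := by
  classical
  let P : Finset E → Prop := fun s =>
    (∀ c ∈ s, ‖c‖ ≤ 1) ∧ ∀ c ∈ s, ∀ d ∈ s, c ≠ d → r ≤ ‖c - d‖
  let Q : ℕ → Prop := fun m => ∃ s : Finset E, P s ∧ s.card = m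
  have hbd : ∀ s, P s → (s.card : ℝ) ≤ (3 / r) ^ Module.finrank ℝ E := fun s hs =>
    card_le_of_separated_of_norm_le_one hr hr1 s hs.1 hs.2
  have hQ0 : Q 0 := ⟨∅, by simp [P], rfl⟩
  let N := ⌊(3 / r) ^ Module.finrank ℝ E⌋₊
  -- A separated set of greatest cardinality is a cover: an uncovered point could be added to it.
  obtain ⟨s, hs, hcard⟩ : Q (Nat.findGreatest Q N) := Nat.findGreatest_spec (Nat.zero_le _) hQ0
  refine ⟨s, hbd s hs, fun x hx => ?_⟩
  by_contra! hfar
  have hxs : x ∉ s := fun hmem => by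
    have := hfar x hmem
    simp only [sub_self, norm_zero] at this
    linarith
  have hP : P (insert x s) := by
    refine ⟨fun c hc => ?_, fun c hc d hd hcd => ?_⟩
    · rcases Finset.mem_insert.1 hc with rfl | hc
      exacts [hx, hs.1 c hc]
    · rcases Finset.mem_insert.1 hc with hcx | hcs <;> rcases Finset.mem_insert.1 hd with hdx | hds
      · exact absurd (hcx.trans hdx.symm) hcd
      · rw [hcx]; exact (hfar d hds).le
      · rw [hdx, norm_sub_rev]; exact (hfar c hcs).le
      · exact hs.2 c hcs d hds hcd
  have hle : (insert x s).card ≤ Nat.findGreatest Q N :=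
    Nat.le_findGreatest (Nat.le_floor (hbd _ hP)) ⟨_, hP, rfl⟩
  rw [Finset.card_insert_of_notMem hxs] at hle
  omega

/-- The parameter set `{|w|₁ = 1} × [-1,1]` in dimension one is covered by `n` balls of radius
`6 / n`. -/
theorem exists_cover_params_one {n : ℕ} (hn : 6 ≤ n) :
    ∃ T : Finset ((Fin 1 → ℝ) × ℝ), T.card ≤ n ∧ ∀ (w : Fin 1 → ℝ) (t : ℝ), ∑ i, |w i| = 1 →
      t ∈ Icc (-1 : ℝ) 1 → ∃ c ∈ T, ∑ i, |w i - c.1 i| + |t - c.2| ≤ 6 / n := by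
  classical
  have hn' : (6 : ℝ) ≤ n := by exact_mod_cast hn
  have hn0 : (0 : ℝ) < n := by linarith
  obtain ⟨s, hs, hcov⟩ := exists_finset_cover_unit_ball ℝ (r := 6 / n) (by positivity)
    ((div_le_one hn0).2 hn')
  refine ⟨({fun _ => 1, fun _ => -1} : Finset (Fin 1 → ℝ)) ×ˢ s, ?_, fun w t hw ht => ?_⟩
  · rw [Module.finrank_self, pow_one] at hs
    have h2 : (3 / (6 / n) : ℝ) = n / 2 := by field_simp; norm_num
    have h3 : 2 * (s.card : ℝ) ≤ n := by rw [h2] at hs; linarith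
    rw [Finset.card_product]
    exact (Nat.mul_le_mul_right _ Finset.card_le_two).trans (by exact_mod_cast h3)
  · obtain ⟨c, hc, hxc⟩ := hcov t (by rw [Real.norm_eq_abs]; exact abs_le.2 ht)
    refine ⟨(w, c), ?_, by simpa using hxc⟩
    simp only [Finset.mem_product, Finset.mem_insert, Finset.mem_singleton]
    refine ⟨?_, hc⟩
    rw [Fin.sum_univ_one] at hw
    rcases (abs_eq zero_le_one).1 hw with h | h
    · left; ext i; rw [Subsingleton.elim i 0, h]
    · right; ext i; rw [Subsingleton.elim i 0, h]

/-- The parameter set `{|w|₁ = 1} × [-1,1]` is covered by `(3 / r) ^ (d + 1)` balls of radius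
`2 r`. -/
theorem exists_cover_params (d : ℕ) {r : ℝ} (hr : 0 < r) (hr1 : r ≤ 1) :
    ∃ T : Finset ((Fin d → ℝ) × ℝ), (T.card : ℝ) ≤ (3 / r) ^ (d + 1) ∧
      ∀ (w : Fin d → ℝ) (t : ℝ), ∑ i, |w i| = 1 → t ∈ Icc (-1 : ℝ) 1 →
        ∃ c ∈ T, ∑ i, |w i - c.1 i| + |t - c.2| ≤ 2 * r := by
  classical
  obtain ⟨s, hs, hcov⟩ := exists_finset_cover_unit_ball (PiLp 1 (fun _ : Fin d => ℝ) × ℝ) hr hr1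
  have hfin : Module.finrank ℝ (PiLp 1 (fun _ : Fin d => ℝ) × ℝ) = d + 1 := by
    rw [Module.finrank_prod, Module.finrank_self,
      LinearEquiv.finrank_eq (WithLp.linearEquiv 1 ℝ (Fin d → ℝ)), Module.finrank_fin_fun]
  rw [hfin] at hs
  have hnorm : ∀ v : PiLp 1 (fun _ : Fin d => ℝ), ‖v‖ = ∑ i, |v i| := fun v => by
    rw [PiLp.norm_eq_of_L1]; rfl
  refine ⟨s.image fun c => (WithLp.ofLp c.1, c.2), ?_, fun w t hw ht => ?_⟩
  · exact le_trans (by exact_mod_cast Finset.card_image_le) hs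
  · obtain ⟨c, hc, hxc⟩ := hcov (WithLp.toLp 1 w, t) (by
      rw [Prod.norm_def, hnorm]
      exact max_le hw.le (by rw [Real.norm_eq_abs]; exact abs_le.2 ht))
    refine ⟨_, Finset.mem_image_of_mem _ hc, ?_⟩
    rw [Prod.norm_def, hnorm] at hxc
    have h1 := (le_max_left _ _).trans hxc
    have h2 := (le_max_right _ _).trans hxc
    rw [Real.norm_eq_abs] at h2
    simp only [Prod.fst_sub, PiLp.sub_apply, Prod.snd_sub] at h1 h2
    linarith

/-- The parameter set `{|w|₁ = 1} × [-1,1]` is covered by `n` balls of radius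
`12 n ^ (-2 / (3 d))`. -/
theorem exists_cover_params_card_le {d : ℕ} (hd : 1 ≤ d) {n : ℕ} (hn : 1 ≤ n) :
    ∃ T : Finset ((Fin d → ℝ) × ℝ), T.card ≤ n ∧ ∀ (w : Fin d → ℝ) (t : ℝ), ∑ i, |w i| = 1 →
      t ∈ Icc (-1 : ℝ) 1 →
        ∃ c ∈ T, ∑ i, |w i - c.1 i| + |t - c.2| ≤ 12 * (n : ℝ) ^ (-(2 / (3 * (d : ℝ)))) := by
  have hn1 : (1 : ℝ) ≤ n := by exact_mod_cast hn
  have hn0 : (0 : ℝ) < n := by linarith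
  have hd1 : (1 : ℝ) ≤ d := by exact_mod_cast hd
  set q : ℝ := (n : ℝ) ^ (-(2 / (3 * (d : ℝ)))) with hq
  have hq0 : 0 < q := Real.rpow_pos_of_pos hn0 _
  -- For q ≥ 1/6 the target radius is at least 2, and every parameter is within 2 of the origin.
  rcases le_or_gt (1 / 6) q with hbig | hsmall
  · refine ⟨{0}, by simpa using hn, fun w t hw ht => ⟨0, by simp, ?_⟩⟩
    have := abs_le.2 ht
    simp only [Prod.fst_zero, Pi.zero_apply, sub_zero, Prod.snd_zero, hw]
    linarith
  obtain rfl | hd2 : d = 1 ∨ 2 ≤ d := by omega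
  · have hqn : (1 : ℝ) / n ≤ q := by
      rw [hq, one_div, ← Real.rpow_neg_one]
      exact Real.rpow_le_rpow_of_exponent_le hn1 (by norm_num)
    have h6 : 6 ≤ n := by
      have h := lt_of_le_of_lt hqn hsmall
      rw [div_lt_div_iff₀ hn0 (by norm_num)] at h
      have : (6 : ℝ) ≤ n := by linarith
      exact_mod_cast this
    obtain ⟨T, hT, hcov⟩ := exists_cover_params_one h6
    refine ⟨T, hT, fun w t hw ht => ?_⟩
    obtain ⟨c, hc, hle⟩ := hcov w t hw ht
    refine ⟨c, hc, hle.trans ?_⟩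
    have : (6 : ℝ) / n = 6 * (1 / n) := by ring
    linarith
  · obtain ⟨T, hT, hcov⟩ := exists_cover_params d (r := 3 * q) (by positivity) (by linarith)
    refine ⟨T, ?_, fun w t hw ht => ?_⟩
    · have h3 : 3 / (3 * q) = (n : ℝ) ^ (2 / (3 * (d : ℝ))) := by
        rw [hq, Real.rpow_neg hn0.le]; field_simp
      have hd2' : (2 : ℝ) ≤ d := by exact_mod_cast hd2
      have h4 : (T.card : ℝ) ≤ n := by
        refine hT.trans ?_
        rw [h3, ← Real.rpow_natCast, ← Real.rpow_mul hn0.le]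
        conv_rhs => rw [← Real.rpow_one (n : ℝ)]
        refine Real.rpow_le_rpow_of_exponent_le hn1 ?_
        -- The condition is 2(d + 1) ≤ 3d, which is where d ≥ 2 is needed.
        rw [div_mul_eq_mul_div, div_le_one (by positivity)]
        push_cast
        linarith
      exact_mod_cast h4
    · obtain ⟨c, hc, hle⟩ := hcov w t hw ht
      exact ⟨c, hc, hle.trans (by linarith)⟩

/-! ### The unit cube and its slabs. -/

theorem measurableSet_unitCube (d : ℕ) : MeasurableSet (unitCube d) := by
  have : unitCube d = Set.pi univ fun _ => Ioo (0 : ℝ) 1 := by ext; simp [unitCube]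
  rw [this]
  exact MeasurableSet.univ_pi fun _ => measurableSet_Ioo

theorem volume_unitCube (d : ℕ) : volume (unitCube d) = 1 := by
  have : unitCube d = Set.pi univ fun _ => Ioo (0 : ℝ) 1 := by ext; simp [unitCube]
  rw [this, Real.volume_pi_Ioo]
  simp

instance isProbabilityMeasure_restrict_unitCube (d : ℕ) :
    IsProbabilityMeasure (volume.restrict (unitCube d)) :=
  ⟨by rw [Measure.restrict_apply_univ, volume_unitCube]⟩

/-- The part of a slab `{|w·x + t| ≤ δ}` inside the unit cube has volume at most `2 δ / |w k|`. -/
theorem volume_slab_le {d : ℕ} (w : Fin d → ℝ) (t δ : ℝ) (k : Fin d) :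
    ENNReal.ofReal |w k| * volume {x ∈ unitCube d | |∑ i, w i * x i + t| ≤ δ} ≤
      ENNReal.ofReal (2 * δ) := by
  classical
  -- Replacing coordinate k by w·x has determinant w k and sends the slab into a box with one side
  -- 2δ and the others 1.
  let M : Matrix (Fin d) (Fin d) ℝ := (1 : Matrix (Fin d) (Fin d) ℝ).updateRow k w
  have hdet : LinearMap.det (Matrix.toLin' M) = w k := by
    rw [LinearMap.det_toLin', ← Matrix.cramer_transpose_apply, Matrix.transpose_one,
      Matrix.cramer_one]
    rfl
  have hMk : ∀ x, (Matrix.toLin' M x) k = ∑ i, w i * x i := fun x => by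
    simp [M, Matrix.mulVec, dotProduct]
  have hMj : ∀ x, ∀ j ≠ k, (Matrix.toLin' M x) j = x j := fun x j hj => by
    simp [M, Matrix.mulVec, hj, dotProduct, Matrix.one_apply]
  rw [← hdet, ← Measure.addHaar_image_linearMap]
  have hsub : Matrix.toLin' M '' {x ∈ unitCube d | |∑ i, w i * x i + t| ≤ δ} ⊆
      Icc (Function.update 0 k (-t - δ)) (Function.update 1 k (-t + δ)) := by
    rintro _ ⟨x, ⟨hx, hxt⟩, rfl⟩
    obtain ⟨h1, h2⟩ := abs_le.1 hxt
    constructor <;> intro j <;> by_cases hj : j = k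
    · subst hj; rw [hMk, Function.update_self]; linarith
    · rw [hMj x j hj, Function.update_of_ne hj]; exact (hx j).1.le
    · subst hj; rw [hMk, Function.update_self]; linarith
    · rw [hMj x j hj, Function.update_of_ne hj]; exact (hx j).2.le
  refine (measure_mono hsub).trans ?_
  rw [Real.volume_Icc_pi, Finset.prod_eq_single k]
  · rw [Function.update_self, Function.update_self]
    exact ENNReal.ofReal_le_ofReal (by linarith)
  · intro j _ hj
    simp [Function.update_of_ne hj]
  · simp

theorem volume_hyperplane_eq_zero {d : ℕ} {w : Fin d → ℝ} (hw : w ≠ 0) (t : ℝ) :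
    volume {x ∈ unitCube d | ∑ i, w i * x i + t = 0} = 0 := by
  obtain ⟨k, hk⟩ := Function.ne_iff.1 hw
  have h := volume_slab_le w t 0 k
  have hset : {x ∈ unitCube d | |∑ i, w i * x i + t| ≤ 0} =
      {x ∈ unitCube d | ∑ i, w i * x i + t = 0} := by
    ext x; simp
  rw [hset, mul_zero, ENNReal.ofReal_zero, nonpos_iff_eq_zero, mul_eq_zero] at h
  refine h.resolve_left ?_
  simpa using hk

/-! ### Ridge functions and their weak gradients. -/

theorem abs_relu_sub_relu_le (a b : ℝ) : |relu a - relu b| ≤ |a - b| := by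
  simpa [relu] using abs_max_sub_max_le_max a 0 b 0

/-- The ridge function `x ↦ σ(w·x + t)`. -/
noncomputable def reluRidge {d : ℕ} (w : Fin d → ℝ) (t : ℝ) (x : Fin d → ℝ) : ℝ :=
  relu (∑ i, w i * x i + t)

open Classical in
/-- The almost everywhere defined partial derivative of `reluRidge w t`. -/
noncomputable def reluRidgeGrad {d : ℕ} (w : Fin d → ℝ) (t : ℝ) (i : Fin d) (x : Fin d → ℝ) : ℝ :=
  if 0 < ∑ j, w j * x j + t then w i else 0

theorem continuous_affine {d : ℕ} (w : Fin d → ℝ) (t : ℝ) :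
    Continuous fun x : Fin d → ℝ => ∑ i, w i * x i + t := by
  fun_prop

theorem lipschitzWith_reluRidge {d : ℕ} (w : Fin d → ℝ) (t : ℝ) :
    LipschitzWith (Real.toNNReal (∑ i, |w i|)) (reluRidge w t) := by
  refine LipschitzWith.of_dist_le_mul fun x y => ?_
  rw [Real.coe_toNNReal _ (Finset.sum_nonneg fun i _ => abs_nonneg _), Real.dist_eq]
  refine (abs_relu_sub_relu_le _ _).trans ?_
  rw [add_sub_add_right_eq_sub, ← Finset.sum_sub_distrib, Finset.sum_mul]
  refine (Finset.abs_sum_le_sum_abs _ _).trans (Finset.sum_le_sum fun i _ => ?_)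
  rw [← mul_sub, abs_mul, ← Real.dist_eq]
  gcongr
  exact dist_le_pi_dist x y i

theorem measurable_reluRidgeGrad {d : ℕ} (w : Fin d → ℝ) (t : ℝ) (i : Fin d) :
    Measurable (reluRidgeGrad w t i) :=
  Measurable.ite (measurableSet_lt measurable_const (continuous_affine w t).measurable)
    measurable_const measurable_const

theorem abs_reluRidgeGrad_le {d : ℕ} (w : Fin d → ℝ) (t : ℝ) (i : Fin d) (x : Fin d → ℝ) :
    |reluRidgeGrad w t i x| ≤ |w i| := by
  unfold reluRidgeGrad
  split_ifs <;> simp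

theorem abs_reluRidge_le {d : ℕ} (w : Fin d → ℝ) (t : ℝ) {x : Fin d → ℝ} (hx : x ∈ unitCube d) :
    |reluRidge w t x| ≤ ∑ i, |w i| + |t| := by
  have h := abs_relu_sub_relu_le (∑ i, w i * x i + t) 0
  simp only [relu, max_self, sub_zero] at h
  refine (h.trans (abs_add_le _ _)).trans ?_
  gcongr
  refine (Finset.abs_sum_le_sum_abs _ _).trans (Finset.sum_le_sum fun i _ => ?_)
  rw [abs_mul]
  exact mul_le_of_le_one_right (abs_nonneg _) (abs_le.2 ⟨by linarith [(hx i).1], (hx i).2.le⟩)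

theorem memLp_reluRidge {d : ℕ} (w : Fin d → ℝ) (t : ℝ) (p : ℝ≥0∞) :
    MemLp (reluRidge w t) p (volume.restrict (unitCube d)) :=
  MemLp.of_bound (lipschitzWith_reluRidge w t).continuous.aestronglyMeasurable
    (∑ i, |w i| + |t|)
    ((ae_restrict_iff' (measurableSet_unitCube d)).2 (.of_forall fun _ => abs_reluRidge_le w t))

theorem memLp_reluRidgeGrad {d : ℕ} (w : Fin d → ℝ) (t : ℝ) (i : Fin d) (p : ℝ≥0∞) :
    MemLp (reluRidgeGrad w t i) p (volume.restrict (unitCube d)) :=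
  MemLp.of_bound (measurable_reluRidgeGrad w t i).aestronglyMeasurable |w i|
    (.of_forall (abs_reluRidgeGrad_le w t i))

/-- Away from the hyperplane `w·x + t = 0`, the line derivative of the ridge function along the
`i`-th axis is `reluRidgeGrad w t i`. -/
theorem lineDeriv_reluRidge {d : ℕ} {w : Fin d → ℝ} {t : ℝ} {x : Fin d → ℝ}
    (hx : ∑ i, w i * x i + t ≠ 0) (i : Fin d) :
    lineDeriv ℝ (reluRidge w t) x (Pi.single i 1) = reluRidgeGrad w t i x := by
  have hline : ∀ s : ℝ, ∑ j, w j * (x + s • (Pi.single i 1 : Fin d → ℝ)) j + t =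
      (∑ j, w j * x j + t) + s * w i := fun s => by
    simp only [Pi.add_apply, Pi.smul_apply, smul_eq_mul, mul_add, Finset.sum_add_distrib,
      Pi.single_apply, mul_ite, mul_one, mul_zero, Finset.sum_ite_eq', Finset.mem_univ, if_true]
    ring
  have hcont : Continuous fun s : ℝ => (∑ j, w j * x j + t) + s * w i := by fun_prop
  have h0 : (∑ j, w j * x j + t) + 0 * w i = ∑ j, w j * x j + t := by ring
  unfold lineDeriv reluRidgeGrad reluRidge
  simp only [hline]
  split_ifs with hpos
  · have hev : ∀ᶠ s : ℝ in nhds 0, 0 < (∑ j, w j * x j + t) + s * w i :=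
      hcont.continuousAt.eventually (lt_mem_nhds (by simpa using hpos))
    have heq : (fun s : ℝ => relu ((∑ j, w j * x j + t) + s * w i)) =ᶠ[nhds 0]
        fun s => (∑ j, w j * x j + t) + s * w i := hev.mono fun s hs => max_eq_left hs.le
    rw [heq.deriv_eq]
    simp
  · have hneg : ∑ j, w j * x j + t < 0 := lt_of_le_of_ne (not_lt.1 hpos) hx
    have hev : ∀ᶠ s : ℝ in nhds 0, (∑ j, w j * x j + t) + s * w i < 0 :=
      hcont.continuousAt.eventually (gt_mem_nhds (by simpa using hneg))
    have heq : (fun s : ℝ => relu ((∑ j, w j * x j + t) + s * w i)) =ᶠ[nhds 0]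
        fun _ => 0 := hev.mono fun s hs => max_eq_right hs.le
    rw [heq.deriv_eq]
    simp

/-- Integration by parts holds on the whole space for a Lipschitz function against a compactly
supported Lipschitz one. The test function vanishes off the cube, and the kink is a null hyperplane
because w ≠ 0. -/
theorem hasWeakGradient_reluRidge {d : ℕ} {w : Fin d → ℝ} (hw : w ≠ 0) (t : ℝ) :
    HasWeakGradient (unitCube d) (reluRidge w t) (reluRidgeGrad w t) where
  locallyIntegrableOn :=
    IntegrableOn.locallyIntegrableOn (memLp_one_iff_integrable.1 (memLp_reluRidge w t 1))
  locallyIntegrableOn_grad i :=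
    IntegrableOn.locallyIntegrableOn (memLp_one_iff_integrable.1 (memLp_reluRidgeGrad w t i 1))
  integral_eq i φ hφ hcs hsupp := by
    obtain ⟨D, hD⟩ := hφ.lipschitzWith_of_hasCompactSupport hcs (by simp)
    have hφ0 : ∀ x ∉ unitCube d, φ x = 0 := fun x hx =>
      image_eq_zero_of_notMem_tsupport fun h => hx (hsupp h)
    have hφd : ∀ x ∉ unitCube d, fderiv ℝ φ x = 0 := fun x hx =>
      image_eq_zero_of_notMem_tsupport fun h => hx (hsupp (tsupport_fderiv_subset ℝ h))
    have key := (lipschitzWith_reluRidge w t).integral_lineDeriv_mul_eq (μ := volume) hD hcs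
      (Pi.single i 1)
    have hdiff : Differentiable ℝ φ := hφ.differentiable (by simp)
    have hR : ∫ x, lineDeriv ℝ φ x (-Pi.single i 1) * reluRidge w t x =
        -∫ x in unitCube d, reluRidge w t x * fderiv ℝ φ x (Pi.single i 1) := by
      rw [← setIntegral_eq_integral_of_forall_compl_eq_zero (s := unitCube d), ← integral_neg]
      · congr 1; ext x
        rw [(hdiff x).lineDeriv_eq_fderiv, map_neg]; ring
      · intro x hx
        rw [(hdiff x).lineDeriv_eq_fderiv, hφd x hx]; simp
    have hL : ∫ x, lineDeriv ℝ (reluRidge w t) x (Pi.single i 1) * φ x =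
        ∫ x in unitCube d, reluRidgeGrad w t i x * φ x := by
      rw [← setIntegral_eq_integral_of_forall_compl_eq_zero (s := unitCube d)]
      · refine setIntegral_congr_ae (measurableSet_unitCube d) ?_
        have hnull := measure_eq_zero_iff_ae_notMem.1 (volume_hyperplane_eq_zero hw t)
        filter_upwards [hnull] with x hx hxc
        rw [lineDeriv_reluRidge fun h => hx ⟨hxc, h⟩]
      · intro x hx
        rw [hφ0 x hx, mul_zero]
    rw [hR, hL] at key
    linarith

/-- Supplies the integrability needed to split integrals of differences against test functions. -/
theorem MeasureTheory.LocallyIntegrableOn.integrableOn_mul_of_forall_notMem {d : ℕ}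
    {Ω K : Set (Fin d → ℝ)} {u ψ : (Fin d → ℝ) → ℝ} (hu : LocallyIntegrableOn u Ω volume)
    (hΩ : MeasurableSet Ω) (hK : IsCompact K) (hKΩ : K ⊆ Ω) (hψ : Continuous ψ)
    (hψ0 : ∀ x ∉ K, ψ x = 0) : IntegrableOn (fun x => u x * ψ x) Ω volume :=
  ((hu.integrableOn_compact_subset hKΩ hK).mul_continuousOn hψ.continuousOn
    hK).of_forall_sdiff_eq_zero hΩ fun x hx => by rw [hψ0 x hx.2, mul_zero]

theorem HasWeakGradient.sub {d : ℕ} {Ω : Set (Fin d → ℝ)} {f f' : (Fin d → ℝ) → ℝ}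
    {g g' : Fin d → (Fin d → ℝ) → ℝ} (hΩ : IsOpen Ω) (h : HasWeakGradient Ω f g)
    (h' : HasWeakGradient Ω f' g') : HasWeakGradient Ω (f - f') (g - g') where
  locallyIntegrableOn := h.locallyIntegrableOn.sub h'.locallyIntegrableOn
  locallyIntegrableOn_grad i :=
    (h.locallyIntegrableOn_grad i).sub (h'.locallyIntegrableOn_grad i)
  integral_eq i φ hφ hcs hsupp := by
    have hfd : Continuous fun x => fderiv ℝ φ x (Pi.single i 1) :=
      (hφ.continuous_fderiv (by simp)).clm_apply continuous_const
    have hfd0 : ∀ x ∉ tsupport φ, fderiv ℝ φ x (Pi.single i 1) = 0 := fun x hx => by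
      rw [image_eq_zero_of_notMem_tsupport fun h => hx (tsupport_fderiv_subset ℝ h)]; rfl
    have hφ0 : ∀ x ∉ tsupport φ, φ x = 0 := fun x => image_eq_zero_of_notMem_tsupport
    have int : ∀ {u ψ : (Fin d → ℝ) → ℝ}, LocallyIntegrableOn u Ω volume → Continuous ψ →
        (∀ x ∉ tsupport φ, ψ x = 0) → IntegrableOn (fun x => u x * ψ x) Ω volume :=
      fun hu hψ hψ0 => hu.integrableOn_mul_of_forall_notMem hΩ.measurableSet hcs hsupp hψ hψ0
    simp only [Pi.sub_apply, sub_mul]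
    rw [integral_sub (int h.locallyIntegrableOn hfd hfd0) (int h'.locallyIntegrableOn hfd hfd0),
      integral_sub (int (h.locallyIntegrableOn_grad i) hφ.continuous hφ0)
        (int (h'.locallyIntegrableOn_grad i) hφ.continuous hφ0),
      h.integral_eq i φ hφ hcs hsupp, h'.integral_eq i φ hφ hcs hsupp]
    ring

theorem isOpen_unitCube (d : ℕ) : IsOpen (unitCube d) := by
  have : unitCube d = Set.pi univ fun _ => Ioo (0 : ℝ) 1 := by ext; simp [unitCube]
  rw [this]
  exact isOpen_set_pi finite_univ fun _ _ => isOpen_Ioo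

/-! ### Hölder continuity of the parametrization. -/

theorem abs_affine_sub_affine_le {d : ℕ} (w w' : Fin d → ℝ) (t t' : ℝ) {x : Fin d → ℝ}
    (hx : x ∈ unitCube d) :
    |(∑ i, w i * x i + t) - (∑ i, w' i * x i + t')| ≤ ∑ i, |w i - w' i| + |t - t'| := by
  rw [add_sub_add_comm, ← Finset.sum_sub_distrib]
  refine (abs_add_le _ _).trans ?_
  gcongr
  refine (Finset.abs_sum_le_sum_abs _ _).trans (Finset.sum_le_sum fun i _ => ?_)
  rw [← sub_mul, abs_mul]
  exact mul_le_of_le_one_right (abs_nonneg _) (abs_le.2 ⟨by linarith [(hx i).1], (hx i).2.le⟩)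

open Classical in
/-- The gradients of two ridge functions are close except where the signs of the affine functions
differ, which happens only in a slab. -/
theorem sq_reluRidgeGrad_sub_le {d : ℕ} (w w' : Fin d → ℝ) (t t' : ℝ) (i : Fin d) {δ : ℝ}
    {x : Fin d → ℝ} (h : |(∑ i, w i * x i + t) - (∑ i, w' i * x i + t')| ≤ δ) :
    (reluRidgeGrad w t i x - reluRidgeGrad w' t' i x) ^ 2 ≤
      2 * (w i - w' i) ^ 2 + if |∑ i, w i * x i + t| ≤ δ then 2 * w i ^ 2 else 0 := by
  unfold reluRidgeGrad
  obtain ⟨h1, h2⟩ := abs_le.1 h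
  have hnn : 0 ≤ if |∑ i, w i * x i + t| ≤ δ then 2 * w i ^ 2 else 0 := by
    split_ifs <;> positivity
  by_cases ha : 0 < ∑ i, w i * x i + t <;> by_cases hb : 0 < ∑ i, w' i * x i + t'
  · rw [if_pos ha, if_pos hb]
    nlinarith [sq_nonneg (w i - w' i)]
  · rw [if_pos ha, if_neg hb, if_pos (abs_le.2 ⟨by linarith, by linarith⟩)]
    nlinarith [sq_nonneg (w i - w' i), sq_nonneg (w i)]
  · rw [if_neg ha, if_pos hb, if_pos (abs_le.2 ⟨by linarith, by linarith⟩)]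
    -- 2(a - b)² + 2a² - b² = (2a - b)².
    nlinarith [sq_nonneg (2 * w i - w' i)]
  · rw [if_neg ha, if_neg hb]
    nlinarith [sq_nonneg (w i - w' i)]

theorem eLpNorm_two_sq {α : Type*} [MeasurableSpace α] (μ : Measure α) (f : α → ℝ) :
    eLpNorm f 2 μ ^ 2 = ∫⁻ x, ENNReal.ofReal (f x ^ 2) ∂μ := by
  have h := eLpNorm_nnreal_pow_eq_lintegral (f := f) (μ := μ) (p := 2) (by norm_num)
  simp only [NNReal.coe_ofNat, ENNReal.rpow_ofNat, ENNReal.coe_ofNat] at h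
  rw [h]
  refine lintegral_congr fun x => ?_
  rw [← ofReal_norm, ← ENNReal.ofReal_pow (norm_nonneg _), Real.norm_eq_abs, sq_abs]

theorem eLpNorm_reluRidge_sub_sq_le {d : ℕ} (w w' : Fin d → ℝ) (t t' : ℝ) :
    eLpNorm (reluRidge w t - reluRidge w' t') 2 (volume.restrict (unitCube d)) ^ 2 ≤
      ENNReal.ofReal ((∑ i, |w i - w' i| + |t - t'|) ^ 2) := by
  rw [eLpNorm_two_sq]
  refine (lintegral_mono_ae ((ae_restrict_iff' (measurableSet_unitCube d)).2
    (.of_forall fun x hx => ENNReal.ofReal_le_ofReal (sq_le_sq' ?_ ?_)))).trans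
    (by rw [lintegral_const, measure_univ, mul_one])
  all_goals
    have h := (abs_relu_sub_relu_le _ _).trans (abs_affine_sub_affine_le w w' t t' hx)
  exacts [(abs_le.1 h).1, (abs_le.1 h).2]

/-- Since |w i|² ≤ |w i| |w k|, the factor |w k| absorbs the slab volume. The remaining bound is
linear in |w i|, so it sums over i through |w|₁ = 1. -/
theorem eLpNorm_reluRidgeGrad_sub_sq_le {d : ℕ} {w : Fin d → ℝ} (w' : Fin d → ℝ) (t t' : ℝ)
    {δ : ℝ} (hδ : ∑ i, |w i - w' i| + |t - t'| ≤ δ) {k : Fin d} (hk : ∀ i, |w i| ≤ |w k|)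
    (i : Fin d) :
    eLpNorm (reluRidgeGrad w t i - reluRidgeGrad w' t' i) 2 (volume.restrict (unitCube d)) ^ 2 ≤
      ENNReal.ofReal (2 * (w i - w' i) ^ 2 + 4 * δ * |w i|) := by
  classical
  have hδ0 : 0 ≤ δ :=
    (add_nonneg (Finset.sum_nonneg fun i _ => abs_nonneg _) (abs_nonneg _)).trans hδ
  set S : Set (Fin d → ℝ) := {x | |∑ i, w i * x i + t| ≤ δ} with hS
  have hSm : MeasurableSet S :=
    (isClosed_le (continuous_affine w t).abs continuous_const).measurableSet
  have hslab : ENNReal.ofReal (2 * w i ^ 2) * (volume.restrict (unitCube d)) S ≤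
      ENNReal.ofReal (4 * δ * |w i|) := by
    have hV : (volume.restrict (unitCube d)) S =
        volume {x ∈ unitCube d | |∑ i, w i * x i + t| ≤ δ} := by
      rw [Measure.restrict_apply hSm, inter_comm]; rfl
    calc ENNReal.ofReal (2 * w i ^ 2) * (volume.restrict (unitCube d)) S
        ≤ ENNReal.ofReal (2 * |w i|) * ENNReal.ofReal |w k| *
          (volume.restrict (unitCube d)) S := by
          rw [← ENNReal.ofReal_mul (by positivity)]
          gcongr ENNReal.ofReal ?_ * _
          rw [← sq_abs, pow_two, ← mul_assoc]
          exact mul_le_mul_of_nonneg_left (hk i) (by positivity)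
      _ ≤ ENNReal.ofReal (2 * |w i|) * ENNReal.ofReal (2 * δ) := by
          rw [mul_assoc, hV]
          gcongr
          exact volume_slab_le w t δ k
      _ = ENNReal.ofReal (4 * δ * |w i|) := by
          rw [← ENNReal.ofReal_mul (by positivity)]
          congr 1; ring
  rw [eLpNorm_two_sq]
  calc ∫⁻ x in unitCube d, ENNReal.ofReal
        ((reluRidgeGrad w t i - reluRidgeGrad w' t' i) x ^ 2)
      ≤ ∫⁻ x in unitCube d, (ENNReal.ofReal (2 * (w i - w' i) ^ 2) +
          S.indicator (fun _ => ENNReal.ofReal (2 * w i ^ 2)) x) := by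
        refine lintegral_mono_ae ((ae_restrict_iff' (measurableSet_unitCube d)).2
          (.of_forall fun x hx => ?_))
        refine (ENNReal.ofReal_le_ofReal (sq_reluRidgeGrad_sub_le w w' t t' i
          ((abs_affine_sub_affine_le w w' t t' hx).trans hδ))).trans ?_
        refine ENNReal.ofReal_add_le.trans ?_
        gcongr
        rw [indicator_apply]
        by_cases hx : |∑ i, w i * x i + t| ≤ δ
        · rw [if_pos hx, if_pos (show x ∈ S from hx)]
        · rw [if_neg hx, if_neg (show x ∉ S from hx), ENNReal.ofReal_zero]
    _ = ENNReal.ofReal (2 * (w i - w' i) ^ 2) +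
          ENNReal.ofReal (2 * w i ^ 2) * (volume.restrict (unitCube d)) S := by
        rw [lintegral_add_left measurable_const, lintegral_const, measure_univ, mul_one,
          lintegral_indicator_const hSm]
    _ ≤ ENNReal.ofReal (2 * (w i - w' i) ^ 2 + 4 * δ * |w i|) := by
        rw [ENNReal.ofReal_add (by positivity) (by positivity)]
        gcongr

theorem ne_zero_of_sum_abs_eq_one {d : ℕ} {w : Fin d → ℝ} (hw : ∑ i, |w i| = 1) : w ≠ 0 := by
  rintro rfl
  simp at hw

/-- The parametrization of the dictionary is Hölder continuous of order `1/2`, with a constant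
that does not depend on the dimension. -/
theorem eH1Norm_reluRidge_sub_le {d : ℕ} {w w' : Fin d → ℝ} {t t' δ : ℝ}
    (hw : ∑ i, |w i| = 1) (hw' : ∑ i, |w' i| = 1) (hδ : ∑ i, |w i - w' i| + |t - t'| ≤ δ) :
    eH1Norm (unitCube d) (reluRidge w t - reluRidge w' t') ≤
      ENNReal.ofReal (3 * δ ^ 2 + 4 * δ) ^ (1 / 2 : ℝ) := by
  have hsum0 : 0 ≤ ∑ i, |w i - w' i| := Finset.sum_nonneg fun i _ => abs_nonneg _
  have hδ0 : 0 ≤ δ := (add_nonneg hsum0 (abs_nonneg _)).trans hδ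
  have hsumδ : ∑ i, |w i - w' i| ≤ δ := by linarith [abs_nonneg (t - t')]
  have : Nonempty (Fin d) := by
    by_contra hempty
    rw [not_nonempty_iff] at hempty
    simp at hw
  obtain ⟨k, hk⟩ := Finite.exists_max fun i => |w i|
  refine (iInf₂_le _ ((hasWeakGradient_reluRidge (ne_zero_of_sum_abs_eq_one hw) t).sub
    (isOpen_unitCube d) (hasWeakGradient_reluRidge (ne_zero_of_sum_abs_eq_one hw') t'))).trans ?_
  gcongr
  calc _ ≤ ENNReal.ofReal (δ ^ 2) +
        ∑ i, ENNReal.ofReal (2 * (w i - w' i) ^ 2 + 4 * δ * |w i|) := by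
        gcongr with i _
        · exact (eLpNorm_reluRidge_sub_sq_le w w' t t').trans
            (ENNReal.ofReal_le_ofReal (pow_le_pow_left₀ (by positivity) hδ 2))
        · exact eLpNorm_reluRidgeGrad_sub_sq_le w' t t' hδ hk i
    _ = ENNReal.ofReal (δ ^ 2 + ∑ i, (2 * (w i - w' i) ^ 2 + 4 * δ * |w i|)) := by
        rw [← ENNReal.ofReal_sum_of_nonneg fun i _ => by positivity,
          ← ENNReal.ofReal_add (by positivity) (Finset.sum_nonneg fun i _ => by positivity)]
    _ ≤ ENNReal.ofReal (3 * δ ^ 2 + 4 * δ) := by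
        refine ENNReal.ofReal_le_ofReal ?_
        have hsq : ∑ i, (w i - w' i) ^ 2 ≤ δ ^ 2 := by
          calc ∑ i, (w i - w' i) ^ 2 ≤ ∑ i, |w i - w' i| * δ := by
                refine Finset.sum_le_sum fun i _ => ?_
                rw [← sq_abs, pow_two]
                exact mul_le_mul_of_nonneg_left ((Finset.single_le_sum
                  (f := fun i => |w i - w' i|) (fun i _ => abs_nonneg _)
                  (Finset.mem_univ i)).trans hsumδ) (abs_nonneg _)
            _ ≤ δ ^ 2 := by
                rw [← Finset.sum_mul, pow_two]
                exact mul_le_mul_of_nonneg_right hsumδ hδ0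
        rw [Finset.sum_add_distrib, ← Finset.mul_sum, ← Finset.mul_sum, hw]
        linarith

/-! ### From parameter covers to metric entropy. -/

theorem metricEntropyH1_reluDictionary_le {d n : ℕ} (T : Finset ((Fin d → ℝ) × ℝ))
    (hT : T.card ≤ n) {ρ : ℝ}
    (hcov : ∀ (w : Fin d → ℝ) (t : ℝ), ∑ i, |w i| = 1 → t ∈ Icc (-1 : ℝ) 1 →
      ∃ c ∈ T, ∑ i, |w i - c.1 i| + |t - c.2| ≤ ρ) :
    metricEntropyH1 (unitCube d) (reluDictionary d) n ≤
      ENNReal.ofReal (3 * (2 * ρ) ^ 2 + 4 * (2 * ρ)) ^ (1 / 2 : ℝ) := by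
  let e : T → Fin n := fun c => Fin.castLE hT (T.equivFin c)
  have he : Function.Injective e := (Fin.castLE_injective hT).comp T.equivFin.injective
  -- Centres need not satisfy |w|₁ = 1, so the Hölder bound is applied to pairs of dictionary
  -- elements in one cell, at distance at most 2ρ.
  refine sInf_le ⟨fun j => {f | ∃ (w : Fin d → ℝ) (t : ℝ) (c : T), ∑ i, |w i| = 1 ∧ e c = j ∧
    ∑ i, |w i - c.1.1 i| + |t - c.1.2| ≤ ρ ∧ f = reluRidge w t}, ?_, ?_⟩
  · rintro f ⟨w, t, hw, ht, rfl⟩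
    obtain ⟨c, hc, hle⟩ := hcov w t hw ht
    exact mem_iUnion.2 ⟨e ⟨c, hc⟩, w, t, ⟨c, hc⟩, hw, rfl, hle, rfl⟩
  · rintro j f ⟨w, t, c, hw, hcj, hle, rfl⟩ g ⟨w', t', c', hw', hcj', hle', rfl⟩
    obtain rfl := he (hcj.trans hcj'.symm)
    refine eH1Norm_reluRidge_sub_le hw hw' ?_
    have h1 : ∑ i, |w i - w' i| ≤ ∑ i, |w i - c.1.1 i| + ∑ i, |w' i - c.1.1 i| := by
      rw [← Finset.sum_add_distrib]
      refine Finset.sum_le_sum fun i _ => ?_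
      rw [abs_sub_comm (w' i)]
      exact abs_sub_le _ _ _
    have h2 : |t - t'| ≤ |t - c.1.2| + |t' - c.1.2| := by
      rw [abs_sub_comm t']
      exact abs_sub_le _ _ _
    linarith

theorem memH1_of_mem_reluDictionary {d : ℕ} {f : (Fin d → ℝ) → ℝ} (hf : f ∈ reluDictionary d) :
    MemH1 (unitCube d) f := by
  obtain ⟨w, t, hw, -, rfl⟩ := hf
  exact ⟨reluRidgeGrad w t, hasWeakGradient_reluRidge (ne_zero_of_sum_abs_eq_one hw) t,
    memLp_reluRidge w t 2, fun i => memLp_reluRidgeGrad w t i 2⟩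

theorem propositionA3 :
    ∃ c : ℝ, 0 < c ∧ ∀ d : ℕ, 1 ≤ d →
      (∀ f ∈ reluDictionary d, MemH1 (unitCube d) f) ∧
      ∀ n : ℕ, 1 ≤ n →
        metricEntropyH1 (unitCube d) (reluDictionary d) n
          ≤ ENNReal.ofReal (c * (n : ℝ) ^ (-(1 / (3 * (d : ℝ))))) := by
  refine ⟨43, by norm_num, fun d hd => ⟨fun f => memH1_of_mem_reluDictionary, fun n hn => ?_⟩⟩
  obtain ⟨T, hT, hcov⟩ := exists_cover_params_card_le hd hn
  refine (metricEntropyH1_reluDictionary_le T hT hcov).trans ?_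
  have hn1 : (1 : ℝ) ≤ n := by exact_mod_cast hn
  have hp0 : 0 < (n : ℝ) ^ (-(1 / (3 * (d : ℝ)))) := Real.rpow_pos_of_pos (by linarith) _
  have hp1 : (n : ℝ) ^ (-(1 / (3 * (d : ℝ)))) ≤ 1 :=
    Real.rpow_le_one_of_one_le_of_nonpos hn1 (neg_nonpos.2 (by positivity))
  have hq : (n : ℝ) ^ (-(2 / (3 * (d : ℝ)))) = ((n : ℝ) ^ (-(1 / (3 * (d : ℝ))))) ^ 2 := by
    rw [← Real.rpow_natCast, ← Real.rpow_mul (by linarith)]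
    congr 1; push_cast; ring
  rw [hq]
  set p : ℝ := (n : ℝ) ^ (-(1 / (3 * (d : ℝ))))
  rw [ENNReal.ofReal_rpow_of_nonneg (by positivity) (by norm_num), ← Real.sqrt_eq_rpow]
  refine ENNReal.ofReal_le_ofReal (Real.sqrt_le_iff.2 ⟨by positivity, ?_⟩)
  -- With ρ = 12p² and p ≤ 1, the radicand 1728p⁴ + 96p² is at most 1824p² ≤ (43p)².
  nlinarith [mul_le_of_le_one_right (sq_nonneg p) (pow_le_one₀ hp0.le hp1 : p ^ 2 ≤ 1)]
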